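/- Formulas of $\mathcal{R}$Ł are built from propositional variables with the connectives $\neg$, $\to$ and $\nabla_r$ ($r\in[0,1]$). Put $\varphi\vee\psi=(\varphi\to\psi)\to\psi$, $\varphi\leftrightarrow\psi=\neg\big((\varphi\to\psi)\to\neg(\psi\to\varphi)\big)$ and $\Delta_r\varphi=\neg\nabla_r\neg\varphi$. The axioms of $\mathcal{R}$Ł are (L1) $\varphi\to(\psi\to\varphi)$, (L2) $(\varphi\to\psi)\to((\psi\to\chi)\to(\varphi\to\chi))$, (L3) $(\varphi\vee\psi)\to(\psi\vee\varphi)$, (L4) $(\neg\psi\to\neg\varphi)\to(\varphi\to\psi)$, (R1) $\nabla_r(\varphi\to\psi)\leftrightarrow(\nabla_r\varphi\to\nabla_r\psi)$, (R2) $\nabla_{\max(0,r-q)}\varphi\leftrightarrow(\nabla_q\varphi\to\nabla_r\varphi)$, (R3) $\nabla_r\nabla_q\varphi\leftrightarrow\nabla_{rq}\varphi$, (R4) $\nabla_1\varphi\leftrightarrow\varphi$, for all $r,q\in[0,1]$, and the only deduction rule is modus ponens. Write $\vdash$ for provability in $\mathcal{R}$Ł. The formulas of $\mathcal{Q}$Ł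 (rational formulas) are those in which only connectives $\nabla_q$ with $q\in[0,1]\cap\mathbb{Q}$ occur; their set is $Form_{\mathcal{Q}L}$. Fix a theorem $\eta$ of $\mathcal{R}$Ł and let $\eta_r=\Delta_r\eta$. A formula $\varphi$ is the limit of a sequence of formulas $(\varphi_n)_{n\in\mathbb{N}}$, written $\varphi=\lim_n\varphi_n$, if for every $r\in[0,1)$ there is $k$ such that $\vdash\eta_r\to(\varphi\leftrightarrow\varphi_n)$ for all $n\ge k$. The logic $\mathcal{R}$Ł$^*$ is $\mathcal{R}$Ł extended by the infinitary rule $(\star)$: if $\varphi=\lim_n\varphi_n$, then from all the premises $\varphi_n$, $n\in\mathbb{N}$, infer $\varphi$. For a set $\Theta$ of formulas, $Thm(\Theta,\mathcal{R}\text{Ł}^*)$ is the set of formulas derivable from $\Theta$ in $\mathcal{R}$Ł$^*$, and $Thm(\varphi,\mathcal{R}\text{Ł}^*)=Thm(\{\varphi\},\mathcal{R}\text{Ł}^*)$. **Proposition.** For every formula $\varphi$ of $\mathcal{R}$Ł there exists a sequence $\Theta=\{\varphi_n\}_{n\in\mathbb{N}}\subseteq Form_{\mathcal{Q}L}$ of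 rational formulas such that $$Thm(\varphi,\mathcal{R}\text{Ł}^*)=Thm(\Theta,\mathcal{R}\text{Ł}^*).$$ -/

import Mathlib

namespace RL

/-- The Łukasiewicz conjunction `r ⊙ q = max (0, r + q - 1)` of the standard MV-algebra `[0,1]`. -/
noncomputable def odot (r q : unitInterval) : unitInterval :=
  ⟨max 0 ((r : ℝ) + (q : ℝ) - 1),
    le_max_left _ _, max_le zero_le_one (by linarith [r.2.2, q.2.2])⟩

/-- Formulas over the propositional variables `V`, with connectives `¬`, `→` and `∇_r` for every
real `r ∈ [0,1]`. -/
inductive Formula (V : Type*) where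
  | var : V → Formula V
  | neg : Formula V → Formula V
  | imp : Formula V → Formula V → Formula V
  | nabla : unitInterval → Formula V → Formula V

namespace Formula

variable {V : Type*}

/-- `φ ∨ ψ = (φ → ψ) → ψ`. -/
def or (φ ψ : Formula V) : Formula V := (φ.imp ψ).imp ψ

/-- `φ ⊙ ψ = ¬ (φ → ¬ ψ)`. -/
def strongAnd (φ ψ : Formula V) : Formula V := (φ.imp ψ.neg).neg

/-- `φ ↔ ψ = (φ → ψ) ⊙ (ψ → φ)`, interpreted as `1 - |φ - ψ|`. -/
def iff (φ ψ : Formula V) : Formula V := (φ.imp ψ).strongAnd (ψ.imp φ)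

/-- `Δ_r φ = ¬ ∇_r ¬ φ`, interpreted as the scalar multiple `r φ`. -/
def delta (r : unitInterval) (φ : Formula V) : Formula V := (nabla r φ.neg).neg

/-- The rational formulas, i.e. the formulas of the subsystem `QŁ`: only the `∇_q` with
`q ∈ [0,1] ∩ ℚ` occur. -/
def IsRational : Formula V → Prop
  | var _ => True
  | neg φ => φ.IsRational
  | imp φ ψ => φ.IsRational ∧ ψ.IsRational
  | nabla r φ => (∃ q : ℚ, (q : ℝ) = (r : ℝ)) ∧ φ.IsRational

end Formula

open Formula in
/-- The axioms (L1)-(L4) of Łukasiewicz logic and the axioms (R1)-(R4) for the operators `∇_r`.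
Here `unitInterval.symm q` is `1 - q`. -/
inductive Ax {V : Type*} : Formula V → Prop
  | l1 (φ ψ : Formula V) : Ax (φ.imp (ψ.imp φ))
  | l2 (φ ψ χ : Formula V) : Ax ((φ.imp ψ).imp ((ψ.imp χ).imp (φ.imp χ)))
  | l3 (φ ψ : Formula V) : Ax ((φ.or ψ).imp (ψ.or φ))
  | l4 (φ ψ : Formula V) : Ax ((ψ.neg.imp φ.neg).imp (φ.imp ψ))
  | r1 (r : unitInterval) (φ ψ : Formula V) :
      Ax ((nabla r (φ.imp ψ)).iff ((nabla r φ).imp (nabla r ψ)))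
  | r2 (r q : unitInterval) (φ : Formula V) :
      Ax ((nabla (odot r (unitInterval.symm q)) φ).iff ((nabla q φ).imp (nabla r φ)))
  | r3 (r q : unitInterval) (φ : Formula V) :
      Ax ((nabla r (nabla q φ)).iff (nabla (r * q) φ))
  | r4 (φ : Formula V) : Ax ((nabla 1 φ).iff φ)

/-- Derivability `Θ ⊢ φ` in `RŁ`: the only rule is modus ponens. -/
inductive Provable {V : Type*} (Θ : Set (Formula V)) : Formula V → Prop
  | hyp {φ : Formula V} : φ ∈ Θ → Provable Θ φ
  | ax {φ : Formula V} : Ax φ → Provable Θ φ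
  | mp {φ ψ : Formula V} : Provable Θ φ → Provable Θ (φ.imp ψ) → Provable Θ ψ

/-- `φ = lim_n φ_n`, the syntactic limit relative to a fixed theorem `η` of `RŁ`: for every
`r ∈ [0,1)` there is `k` such that `⊢ η_r → (φ ↔ φ_n)` in `RŁ` for all `n ≥ k`, where
`η_r = Δ_r η`. -/
def IsLimit {V : Type*} (η : Formula V) (s : ℕ → Formula V) (φ : Formula V) : Prop :=
  ∀ r : unitInterval, r < 1 → ∃ k : ℕ, ∀ n : ℕ, k ≤ n →
    Provable ∅ ((Formula.delta r η).imp (φ.iff (s n)))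

/-- Derivability in `RŁ*`: `RŁ` together with the infinitary rule `(⋆)` that derives
`φ` from `φ_0, φ_1, …` whenever `φ = lim_n φ_n`. -/
inductive ProvableStar {V : Type*} (η : Formula V) (Θ : Set (Formula V)) : Formula V → Prop
  | hyp {φ : Formula V} : φ ∈ Θ → ProvableStar η Θ φ
  | ax {φ : Formula V} : Ax φ → ProvableStar η Θ φ
  | mp {φ ψ : Formula V} :
      ProvableStar η Θ φ → ProvableStar η Θ (φ.imp ψ) → ProvableStar η Θ ψ
  | lim {s : ℕ → Formula V} {φ : Formula V} :
      IsLimit η s φ → (∀ n, ProvableStar η Θ (s n)) → ProvableStar η Θ φ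

/-- `Thm(Θ, RŁ*)`, the theory determined by `Θ` in `RŁ*`. -/
def ThmStar {V : Type*} (η : Formula V) (Θ : Set (Formula V)) : Set (Formula V) :=
  {ψ | ProvableStar η Θ ψ}

end RL

namespace RL

namespace Provable

open Formula

variable {V : Type*} {Θ : Set (Formula V)} {φ ψ χ ξ : Formula V}

/-! Every formula φ can be squeezed between rational formulas `lo` and `up` whose gap is provably as
small as desired (`exists_rational_bracket`, by induction on φ). Taking gaps 1/(n+1) and keeping
only the upper bounds gives θ_n with ⊢ φ → θ_n and φ = lim θ_n. Modus ponens then derives each θ_n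
from φ, and one use of (⋆) derives φ from all the θ_n. Semantically ∇_r x = 1 - r(1 - x), so a
refutable β makes ∇_r β the constant 1 - r; with β = ¬η this is how errors are expressed and
compared with η_r. -/

theorem trans (h : Provable Θ (φ.imp ψ)) (h' : Provable Θ (ψ.imp χ)) : Provable Θ (φ.imp χ) :=
  mp h' (mp h (ax (.l2 φ ψ χ)))

theorem weaken (h : Provable Θ φ) (ψ : Formula V) : Provable Θ (ψ.imp φ) :=
  mp h (ax (.l1 φ ψ))

/-- (L1) gives φ → (ψ ∨ φ), and (L3) swaps the disjuncts. -/
theorem assertion (φ ψ : Formula V) : Provable Θ (φ.imp ((φ.imp ψ).imp ψ)) :=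
  trans (ax (.l1 φ (ψ.imp φ))) (ax (.l3 ψ φ))

theorem exchange (h : Provable Θ (φ.imp (ψ.imp χ))) : Provable Θ (ψ.imp (φ.imp χ)) :=
  trans (assertion ψ χ) (mp h (ax (.l2 _ _ _)))

theorem refl (φ : Formula V) : Provable Θ (φ.imp φ) :=
  mp (ax (.l1 φ φ)) (exchange (ax (.l1 φ (φ.imp (φ.imp φ)))))

theorem imp_imp_imp_right (χ : Formula V) (h : Provable Θ (φ.imp ψ)) :
    Provable Θ ((χ.imp φ).imp (χ.imp ψ)) :=
  mp h (exchange (ax (.l2 _ _ _)))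

theorem imp_imp_imp_left (χ : Formula V) (h : Provable Θ (φ.imp ψ)) :
    Provable Θ ((ψ.imp χ).imp (φ.imp χ)) :=
  mp h (ax (.l2 _ _ _))

theorem neg_imp_imp (φ ψ : Formula V) : Provable Θ (φ.neg.imp (φ.imp ψ)) :=
  trans (ax (.l1 _ ψ.neg)) (ax (.l4 _ _))

theorem of_neg_neg (φ : Formula V) : Provable Θ (φ.neg.neg.imp φ) :=
  have h : Provable Θ (φ.neg.neg.imp ((φ.imp φ).imp φ)) :=
    trans (neg_imp_imp φ.neg (φ.imp φ).neg) (ax (.l4 _ _))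
  mp (refl φ) (exchange h)

theorem neg_neg_intro (φ : Formula V) : Provable Θ (φ.imp φ.neg.neg) :=
  mp (of_neg_neg _) (ax (.l4 _ _))

theorem contrapose_imp (φ ψ : Formula V) : Provable Θ ((φ.imp ψ).imp (ψ.neg.imp φ.neg)) :=
  trans (imp_imp_imp_left ψ (of_neg_neg φ))
    (trans (imp_imp_imp_right _ (neg_neg_intro ψ)) (ax (.l4 _ _)))

theorem contrapose (h : Provable Θ (φ.imp ψ)) : Provable Θ (ψ.neg.imp φ.neg) :=
  mp h (contrapose_imp _ _)

theorem imp_of_neg_imp_neg (h : Provable Θ (ψ.neg.imp φ.neg)) : Provable Θ (φ.imp ψ) :=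
  mp h (ax (.l4 _ _))

theorem strongAnd_left (φ ψ : Formula V) : Provable Θ ((φ.strongAnd ψ).imp φ) :=
  trans (contrapose (neg_imp_imp φ ψ.neg)) (of_neg_neg φ)

theorem strongAnd_right (φ ψ : Formula V) : Provable Θ ((φ.strongAnd ψ).imp ψ) :=
  trans (contrapose (ax (.l1 ψ.neg φ))) (of_neg_neg ψ)

theorem strongAnd_intro (φ ψ : Formula V) : Provable Θ (φ.imp (ψ.imp (φ.strongAnd ψ))) :=
  trans (assertion φ ψ.neg)
    (trans (contrapose_imp _ _) (imp_imp_imp_left _ (neg_neg_intro ψ)))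

theorem iff_mp (h : Provable Θ (φ.iff ψ)) : Provable Θ (φ.imp ψ) :=
  mp h (strongAnd_left _ _)

theorem iff_mpr (h : Provable Θ (φ.iff ψ)) : Provable Θ (ψ.imp φ) :=
  mp h (strongAnd_right _ _)

theorem nabla_zero (φ : Formula V) : Provable Θ (nabla 0 φ) := by
  have h : odot 0 (unitInterval.symm 0) = 0 := by
    ext; simp [odot]
  have h2 := iff_mpr (ax (Θ := Θ) (.r2 0 0 φ))
  rw [h] at h2
  exact mp (refl _) h2

theorem nabla_antitone {q r : unitInterval} (h : q ≤ r) (φ : Formula V) :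
    Provable Θ ((nabla r φ).imp (nabla q φ)) := by
  have h1 : odot q (unitInterval.symm r) = 0 := by
    ext
    simpa [odot] using (show (q : ℝ) + (1 - r) ≤ 1 by linarith [show (q : ℝ) ≤ r from h])
  have h2 := iff_mp (ax (Θ := Θ) (.r2 q r φ))
  rw [h1] at h2
  exact mp (nabla_zero φ) h2

theorem imp_nabla (r : unitInterval) (φ : Formula V) : Provable Θ (φ.imp (nabla r φ)) :=
  trans (iff_mpr (ax (.r4 φ))) (nabla_antitone r.2.2 φ)

theorem nabla_imp_nabla (r : unitInterval) (φ ψ : Formula V) :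
    Provable Θ ((φ.imp ψ).imp ((nabla r φ).imp (nabla r ψ))) :=
  trans (imp_nabla r _) (iff_mp (ax (.r1 r φ ψ)))

theorem nabla_mono (r : unitInterval) (h : Provable Θ (φ.imp ψ)) :
    Provable Θ ((nabla r φ).imp (nabla r ψ)) :=
  mp h (nabla_imp_nabla r φ ψ)

theorem nabla_sub_imp {q r d : unitInterval} (h : (r : ℝ) - q ≤ d) (φ : Formula V) :
    Provable Θ ((nabla d φ).imp ((nabla q φ).imp (nabla r φ))) := by
  refine trans (nabla_antitone ?_ φ) (iff_mp (ax (.r2 r q φ)))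
  refine max_le d.2.1 ?_
  rw [unitInterval.coe_symm_eq]
  linarith

theorem imp_nabla_sub {q r d : unitInterval} (h : (d : ℝ) ≤ r - q) (φ : Formula V) :
    Provable Θ (((nabla q φ).imp (nabla r φ)).imp (nabla d φ)) := by
  refine trans (iff_mpr (ax (.r2 r q φ))) (nabla_antitone ?_ φ)
  refine le_trans (b := (r : ℝ) + (unitInterval.symm q : ℝ) - 1) ?_ (le_max_right _ _)
  rw [unitInterval.coe_symm_eq]
  linarith

theorem neg_imp_nabla_symm (r : unitInterval) :
    Provable Θ ((nabla r φ).neg.imp (nabla (unitInterval.symm r) φ)) :=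
  trans (neg_imp_imp _ (nabla 1 φ)) (imp_nabla_sub (by simp) φ)

section Refutable

variable {β : Formula V} (hβ : Provable Θ β.neg)
include hβ

theorem nabla_symm_imp_neg (r : unitInterval) :
    Provable Θ ((nabla (unitInterval.symm r) β).imp (nabla r β).neg) :=
  have h : Provable Θ ((nabla 1 β).neg) := mp hβ (contrapose (iff_mp (ax (.r4 β))))
  trans (nabla_sub_imp (q := r) (r := 1) (by simp) β) (mp h (exchange (contrapose_imp _ _)))

/-- Łukasiewicz logic has no contraction, so using an error bound twice costs a doubled error: (1 -
t) ⊙ (1 - t) = max(0, 1 - 2t) ≥ 1 - s. -/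
theorem contract {s t : unitInterval} (hst : 2 * (t : ℝ) ≤ s)
    (h : Provable Θ ((nabla t β).imp ((nabla t β).imp χ))) :
    Provable Θ ((nabla s β).imp χ) := by
  have h1 : Provable Θ (χ.neg.imp ((nabla t β).imp (nabla t β).neg)) :=
    exchange (trans h (contrapose_imp _ _))
  have h2 : Provable Θ ((nabla t β).neg.imp (nabla (unitInterval.symm t) β)) :=
    neg_imp_nabla_symm t
  have h3 : Provable Θ (((nabla t β).imp (nabla (unitInterval.symm t) β)).imp
      (nabla (unitInterval.symm s) β)) :=
    imp_nabla_sub (by simp only [unitInterval.coe_symm_eq]; linarith) β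
  exact imp_of_neg_imp_neg
    (trans h1 (trans (imp_imp_imp_right _ h2) (trans h3 (nabla_symm_imp_neg hβ s))))

theorem contract_two {s t : unitInterval} (hst : 2 * (t : ℝ) ≤ s)
    (h : Provable Θ ((nabla t β).imp φ)) (h' : Provable Θ ((nabla t β).imp ψ))
    (hχ : Provable Θ (φ.imp (ψ.imp χ))) : Provable Θ ((nabla s β).imp χ) :=
  contract hβ hst (trans h (trans hχ (imp_imp_imp_left χ h')))

end Refutable

end Provable

theorem exists_rat_bracket (r : unitInterval) {d : ℝ} (hd : 0 < d) :
    ∃ p q : unitInterval, (∃ a : ℚ, (a : ℝ) = p) ∧ (∃ a : ℚ, (a : ℝ) = q) ∧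
      p ≤ r ∧ r ≤ q ∧ (q : ℝ) - p ≤ d := by
  obtain ⟨n, hn⟩ := exists_nat_one_div_lt hd
  have hN : (0 : ℝ) < (n : ℝ) + 1 := by positivity
  set N : ℝ := (n : ℝ) + 1 with hNdef
  have hx0 : 0 ≤ (r : ℝ) * N := mul_nonneg r.2.1 hN.le
  have hx1 : (r : ℝ) * N ≤ N := mul_le_of_le_one_left hN.le r.2.2
  have hf := Nat.floor_le hx0
  have hc := Nat.le_ceil ((r : ℝ) * N)
  have hcN : (⌈(r : ℝ) * N⌉₊ : ℝ) ≤ N := by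
    have : ⌈(r : ℝ) * N⌉₊ ≤ n + 1 := Nat.ceil_le.2 (by push_cast; exact hx1)
    simpa [hNdef] using (Nat.cast_le (α := ℝ)).2 this
  have hcf : (⌈(r : ℝ) * N⌉₊ : ℝ) ≤ ⌊(r : ℝ) * N⌋₊ + 1 := by
    exact_mod_cast Nat.ceil_le_floor_add_one ((r : ℝ) * N)
  refine ⟨⟨⌊(r : ℝ) * N⌋₊ / N, by positivity, (div_le_one hN).2 (hf.trans hx1)⟩,
    ⟨⌈(r : ℝ) * N⌉₊ / N, by positivity, (div_le_one hN).2 hcN⟩,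
    ⟨⌊(r : ℝ) * N⌋₊ / ((n : ℚ) + 1), by push_cast; rfl⟩,
    ⟨⌈(r : ℝ) * N⌉₊ / ((n : ℚ) + 1), by push_cast; rfl⟩,
    (div_le_iff₀ hN).2 hf, (le_div_iff₀ hN).2 hc, ?_⟩
  refine le_trans ?_ hn.le
  rw [← sub_div]
  exact div_le_div_of_nonneg_right (by linarith) hN.le

open Formula Provable in
/-- Every formula lies between two rational formulas whose distance is provably at most `s`,
where `∇_s β` with `β` refutable plays the role of the truth constant `1 - s`. -/
theorem exists_rational_bracket {V : Type*} {Θ : Set (Formula V)} {β : Formula V}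
    (hβ : Provable Θ β.neg) (φ : Formula V) (s : unitInterval) (hs : 0 < s) :
    ∃ lo up : Formula V, lo.IsRational ∧ up.IsRational ∧
      Provable Θ (lo.imp φ) ∧ Provable Θ (φ.imp up) ∧
      Provable Θ ((nabla s β).imp (up.imp lo)) := by
  have half (s : unitInterval) (hs : 0 < s) :
      ∃ t : unitInterval, 0 < t ∧ 2 * (t : ℝ) ≤ s := by
    have hs' : (0 : ℝ) < s := hs
    refine ⟨⟨s / 2, by linarith, by linarith [s.2.2]⟩, ?_, ?_⟩
    · exact half_pos hs'
    · simp only; linarith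
  induction φ generalizing s with
  | var v => exact ⟨.var v, .var v, trivial, trivial, refl _, refl _, weaken (refl _) _⟩
  | neg φ ih =>
    obtain ⟨lo, up, hlo, hup, h1, h2, h3⟩ := ih s hs
    exact ⟨up.neg, lo.neg, hup, hlo, contrapose h2, contrapose h1, trans h3 (contrapose_imp _ _)⟩
  | imp φ ψ ihφ ihψ =>
    obtain ⟨t, ht, hts⟩ := half s hs
    obtain ⟨lo, up, hlo, hup, h1, h2, h3⟩ := ihφ t ht
    obtain ⟨lo', up', hlo', hup', h1', h2', h3'⟩ := ihψ t ht
    refine ⟨up.imp lo', lo.imp up', ⟨hup, hlo'⟩, ⟨hlo, hup'⟩,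
      trans (imp_imp_imp_left _ h2) (imp_imp_imp_right _ h1'),
      trans (imp_imp_imp_left _ h1) (imp_imp_imp_right _ h2'),
      contract_two hβ hts h3 h3' ?_⟩
    have h : Provable Θ ((lo.imp up').imp ((up'.imp lo').imp (lo.imp lo'))) := ax (.l2 _ _ _)
    exact exchange (Provable.trans (exchange h)
      (exchange (Provable.trans (ax (.l2 up lo lo')) (exchange (ax (.l2 _ _ _))))))
  | nabla r φ ih =>
    obtain ⟨t, ht, hts⟩ := half s hs
    obtain ⟨lo, up, hlo, hup, h1, h2, h3⟩ := ih t ht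
    obtain ⟨p, q, hp, hq, hpr, hrq, hpq⟩ := exists_rat_bracket r (d := t) ht
    -- ∇ is antitone in its index, so the larger index q goes with the lower bound. Half of the
    -- error pays for moving p to q, the other half for moving `up` to `lo`.
    refine ⟨nabla q lo, nabla p up, ⟨hq, hlo⟩, ⟨hp, hup⟩,
      trans (nabla_antitone hrq _) (nabla_mono r h1),
      trans (nabla_mono r h2) (nabla_antitone hpr _),
      contract_two hβ hts
        (trans (nabla_mono t (mp hβ (neg_imp_imp β up))) (nabla_sub_imp hpq up))
        (trans h3 (nabla_imp_nabla q up lo)) (ax (.l2 _ _ _))⟩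

theorem Provable.provableStar {V : Type*} {η : Formula V} {Θ : Set (Formula V)} {φ : Formula V}
    (h : Provable ∅ φ) : ProvableStar η Θ φ := by
  induction h with
  | hyp h => exact h.elim
  | ax h => exact .ax h
  | mp _ _ h h' => exact .mp h h'

/-- The side condition of (⋆) is provability from no premises, so it survives a change of premises.
-/
theorem ProvableStar.cut {V : Type*} {η : Formula V} {Θ Ξ : Set (Formula V)} {φ : Formula V}
    (h : ProvableStar η Θ φ) (hΘ : ∀ θ ∈ Θ, ProvableStar η Ξ θ) : ProvableStar η Ξ φ := by
  induction h with
  | hyp h => exact hΘ _ h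
  | ax h => exact .ax h
  | mp _ _ h h' => exact .mp h h'
  | lim hl _ h => exact .lim hl h

open Formula Provable in
/-- Every formula is the syntactic limit of rational formulas that it implies. -/
theorem exists_rational_limit {V : Type*} {η : Formula V} (hη : Provable ∅ η) (φ : Formula V) :
    ∃ θ : ℕ → Formula V, (∀ n, (θ n).IsRational) ∧
      (∀ n, Provable ∅ (φ.imp (θ n))) ∧ IsLimit η θ φ := by
  have hβ : Provable ∅ η.neg.neg := mp hη (neg_neg_intro η)
  let s (n : ℕ) : unitInterval :=
    ⟨1 / ((n : ℝ) + 1), by positivity, (div_le_one (by positivity)).2 (by simp)⟩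
  have hs (n : ℕ) : 0 < s n := show (0 : ℝ) < 1 / ((n : ℝ) + 1) by positivity
  choose lo up _ hup h1 h2 h3 using fun n => exists_rational_bracket hβ φ (s n) (hs n)
  refine ⟨up, hup, h2, fun r hr => ?_⟩
  obtain ⟨k, hk⟩ := exists_nat_one_div_lt (sub_pos.2 (show (r : ℝ) < 1 from hr))
  refine ⟨k, fun n hn => ?_⟩
  have hle : s n ≤ unitInterval.symm r := by
    refine le_trans (b := 1 / ((k : ℝ) + 1)) ?_ hk.le
    exact one_div_le_one_div_of_le (by positivity) (by exact_mod_cast Nat.succ_le_succ hn)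
  -- η_r is ¬∇_r ¬η, which implies ∇_{1-r} ¬η and hence ∇_{s n} ¬η, the premise of the bracket.
  exact trans (neg_imp_nabla_symm r) (trans (nabla_antitone hle _)
    (trans (h3 n) (trans (imp_imp_imp_right _ (h1 n)) (mp (h2 n) (strongAnd_intro _ _)))))

end RL

theorem mainTheorem12 {V : Type*} (η : RL.Formula V) (hη : RL.Provable ∅ η)
    (φ : RL.Formula V) :
    ∃ θ : ℕ → RL.Formula V, (∀ n, (θ n).IsRational) ∧
      RL.ThmStar η {φ} = RL.ThmStar η (Set.range θ) := by
  obtain ⟨θ, hrat, himp, hlim⟩ := RL.exists_rational_limit hη φ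
  refine ⟨θ, hrat, Set.ext fun ψ => ⟨fun h => h.cut ?_, fun h => h.cut ?_⟩⟩
  · rintro _ rfl
    exact .lim hlim fun n => .hyp ⟨n, rfl⟩
  · rintro _ ⟨n, rfl⟩
    exact .mp (.hyp rfl) (himp n).provableStar
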